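/- Let $d\in\mathbb N$. Let $D=D[0,1]$ be the set of functions $f:[0,1]\to\mathbb R^d$ that are right continuous with left limits and left continuous at $1$; put $f(0-):=f(0)$, and let $[[a,b]]$ denote the line segment from $a$ to $b$ in $\mathbb R^d$. For $f\in D$ let $\Gamma_f=\{(z,t)\in\mathbb R^d\times[0,1]: z=f(t-)\text{ or }z=f(t)\}$ and $\overline{\Gamma_f}=\{(z,t)\in\mathbb R^d\times[0,1]: z\in[[f(t-),f(t)]]\}$. A parametric representation of $\overline{\Gamma_f}$ is a pair of continuous maps $u:[0,1]\to\mathbb R^d$, $r:[0,1]\to[0,1]$ such that $(u,r)$ maps $[0,1]$ onto $\overline{\Gamma_f}$ and is non-decreasing for the order "$(z_1,t_1)\le(z_2,t_2)$ iff $t_1<t_2$, or $t_1=t_2$ and $|f(t_1-)-z_1|\le|f(t_2-)-z_2|$". Define $$d_{J_1}(f,g)=\inf_{\lambda}\ \|f\circ\lambda-g\|_\infty\vee\|\lambda-\mathrm{id}\|_\infty,\qquad d_{M_1}(f,g)=\inf\ \|u_1-u_2\|_\infty\vee\|r_1-r_2\|_\infty,$$ where $\lambda$ runs through the continuous bijections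 of $[0,1]$, and $(u_1,r_1)$, $(u_2,r_2)$ through the parametric representations of $\overline{\Gamma_f}$, $\overline{\Gamma_g}$ respectively. Let $d_{J_2}(f,g)$ and $d_{M_2}(f,g)$ be the Hausdorff distances between $\Gamma_f,\Gamma_g$ and between $\overline{\Gamma_f},\overline{\Gamma_g}$, respectively, for the metric $|x-y|\vee|t-s|$ on $\mathbb R^d\times[0,1]$. For $T\in\{J_1,J_2,M_1,M_2\}$, a sequence $(f_n)$ in $D$ converges to $f\in D$ in $T$ if $d_T(f_n,f)\to0$, and it converges in $T$ if it converges in $T$ to some $f\in D$. For every $n\ge1$ let $y^{(n)}=(y^{(n)}_0,y^{(n)}_1,\dots)$ be a sequence in $\mathbb R^d$. A $T$-embedding of $y^{(n)}$ is a function $x^{n,T}\in D$ such that for all integers $0\le k<n$ we have $x^{n,T}(\tfrac kn)=y^{(n)}_k$ and, for all $t\in(\tfrac kn,\tfrac{k+1}n)$, $$x^{n,J_1}(t)=y^{(n)}_k,\quad x^{n,J_2}(t)\in\{y^{(n)}_k,y^{(n)}_{k+1}\},\quad x^{n,M_1}(t)=y^{(n)}_k+n\left(t-\tfrac kn\right)\left(y^{(n)}_{k+1}-y^{(n)}_k\right),\quad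 x^{n,M_2}(t)\in[[y^{(n)}_k,y^{(n)}_{k+1}]],$$ respectively. Theorem. Let $T\in\{J_1,J_2,M_1,M_2\}$ and, for every $n\ge1$, let $x^{n,T}$ be a $T$-embedding of $y^{(n)}$ and $x^{n,J_1}$ the $J_1$-embedding of $y^{(n)}$. If $T\ne J_1$, assume that $|y^{(n)}_n-y^{(n)}_{n-1}|\to0$ as $n\to\infty$ (for instance $y^{(n)}_n=y^{(n)}_{n-1}$, i.e. only $y^{(n)}_0,\dots,y^{(n)}_{n-1}$ matter). Then $(x^{n,T})_n$ converges in $T$ if and only if $(x^{n,J_1})_n$ converges in $T$. More precisely, for every $f\in D$, $(x^{n,T})_n$ converges to $f$ in $T$ if and only if $(x^{n,J_1})_n$ converges to $f$ in $T$. -/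

import Mathlib

open Set Filter Topology
open scoped unitInterval ENNReal

noncomputable section

/-- Euclidean space `ℝ^d`. -/
abbrev Rd (d : ℕ) : Type := EuclideanSpace ℝ (Fin d)

/-- The Skorokhod space `D[0,1]`: right continuous functions `[0,1] → ℝ^d` with left limits
which are moreover left continuous at `1`.  (At `t = 0` the filter `𝓝[<] t` is `⊥`, and at
`t = 1` the filter `𝓝[>] t` is `⊥`, so nothing is required from outside of `[0,1]`.) -/
structure SkorokhodSpace (d : ℕ) where
  toFun : I → Rd d
  right_cont : ∀ t : I, Tendsto toFun (𝓝[>] t) (𝓝 (toFun t))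
  left_lim : ∀ t : I, ∃ l : Rd d, Tendsto toFun (𝓝[<] t) (𝓝 l)
  left_cont_one : Tendsto toFun (𝓝[<] (1 : I)) (𝓝 (toFun 1))

instance (d : ℕ) : CoeFun (SkorokhodSpace d) (fun _ => I → Rd d) := ⟨SkorokhodSpace.toFun⟩

namespace SkorokhodSpace

variable {d : ℕ}

/-- The left limit `f(t-)`, with the convention `f(0-) = f(0)`. -/
def leftLimit (f : SkorokhodSpace d) (t : I) : Rd d := Function.leftLim f.toFun t

/-- The incomplete graph `Γ_f`. -/
def graph (f : SkorokhodSpace d) : Set (Rd d × I) :=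
  {p | p.1 = f.leftLimit p.2 ∨ p.1 = f p.2}

/-- The complete graph of `f`: jumps are filled in by the line segment `[[f(t-), f(t)]]`. -/
def completeGraph (f : SkorokhodSpace d) : Set (Rd d × I) :=
  {p | p.1 ∈ segment ℝ (f.leftLimit p.2) (f p.2)}

/-- The order on the complete graph: by time, and at equal times by the distance to `f(t-)`. -/
def graphLE (f : SkorokhodSpace d) (p q : Rd d × I) : Prop :=
  p.2 < q.2 ∨ (p.2 = q.2 ∧ dist (f.leftLimit p.2) p.1 ≤ dist (f.leftLimit q.2) q.1)

/-- `(u, r)` is a parametric representation of the complete graph of `f`. -/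
structure IsParamRep (f : SkorokhodSpace d) (u : I → Rd d) (r : I → I) : Prop where
  cont_u : Continuous u
  cont_r : Continuous r
  range_eq : range (fun s => (u s, r s)) = f.completeGraph
  mono : ∀ s t : I, s ≤ t → f.graphLE (u s, r s) (u t, r t)

/-- `d_{J₁}`: infimum over the continuous bijections `l` of `[0,1]` of
`‖f ∘ l - g‖_∞ ∨ ‖l - id‖_∞`. -/
def distJ1 (f g : SkorokhodSpace d) : ℝ≥0∞ :=
  ⨅ (l : I → I) (_ : Function.Bijective l ∧ Continuous l),
    (⨆ t : I, edist (f (l t)) (g t)) ⊔ (⨆ t : I, edist (l t) t)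

/-- `d_{J₂}`: Hausdorff distance of the incomplete graphs, for the metric
`|x - y| ∨ |t - s|` on `ℝ^d × [0,1]`. -/
def distJ2 (f g : SkorokhodSpace d) : ℝ≥0∞ := Metric.hausdorffEDist f.graph g.graph

/-- `d_{M₁}`: infimum of `‖u₁ - u₂‖_∞ ∨ ‖r₁ - r₂‖_∞` over all parametric representations. -/
def distM1 (f g : SkorokhodSpace d) : ℝ≥0∞ :=
  ⨅ (u₁ : I → Rd d) (r₁ : I → I) (u₂ : I → Rd d) (r₂ : I → I)
    (_ : f.IsParamRep u₁ r₁ ∧ g.IsParamRep u₂ r₂),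
    (⨆ t : I, edist (u₁ t) (u₂ t)) ⊔ (⨆ t : I, edist (r₁ t) (r₂ t))

/-- `d_{M₂}`: Hausdorff distance of the complete graphs. -/
def distM2 (f g : SkorokhodSpace d) : ℝ≥0∞ :=
  Metric.hausdorffEDist f.completeGraph g.completeGraph

end SkorokhodSpace

/-- The four Skorokhod topologies. -/
inductive SkorokhodTopology : Type
  | J1 | J2 | M1 | M2

/-- The metric `d_T` (with values written in `[0,∞]`). -/
def skorokhodDist {d : ℕ} : SkorokhodTopology → SkorokhodSpace d → SkorokhodSpace d → ℝ≥0∞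
  | .J1 => SkorokhodSpace.distJ1
  | .J2 => SkorokhodSpace.distJ2
  | .M1 => SkorokhodSpace.distM1
  | .M2 => SkorokhodSpace.distM2

/-- `x n` converges to `f` in the topology `T`, i.e. `d_T (x n, f) → 0`. -/
def SkorokhodConverges {d : ℕ} (T : SkorokhodTopology) (x : ℕ → SkorokhodSpace d)
    (f : SkorokhodSpace d) : Prop :=
  Tendsto (fun n => skorokhodDist T (x n) f) atTop (𝓝 0)

/-- The rule of the `T`-embedding for the value at a time `t ∈ (k/n, (k+1)/n)`: step functions for
`J₁`, multiple steps for `J₂`, linear interpolation for `M₁`, any value in the segment for `M₂`. -/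
def EmbeddingRule {d : ℕ} (T : SkorokhodTopology) (n : ℕ) (y : ℕ → Rd d) (k : ℕ) (t : ℝ)
    (z : Rd d) : Prop :=
  match T with
  | .J1 => z = y k
  | .J2 => z = y k ∨ z = y (k + 1)
  | .M1 => z = y k + ((n : ℝ) * (t - (k : ℝ) / n)) • (y (k + 1) - y k)
  | .M2 => z ∈ segment ℝ (y k) (y (k + 1))

/-- `x ∈ D[0,1]` is a `T`-embedding with step size `1/n` of the discrete path `y`. The value
`x 1` is determined by membership in `D[0,1]`. -/
structure IsSkorokhodEmbedding {d : ℕ} (T : SkorokhodTopology) (n : ℕ) (y : ℕ → Rd d)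
    (x : SkorokhodSpace d) : Prop where
  at_grid : ∀ k < n, ∀ t : I, (t : ℝ) = (k : ℝ) / n → x t = y k
  between : ∀ k < n, ∀ t : I, (k : ℝ) / n < t → (t : ℝ) < ((k : ℝ) + 1) / n →
    EmbeddingRule T n y k t (x t)

end

/-! For `T = J1` the embedding is unique: left continuity at `1` forces the value `y (n - 1)` there,
so there is nothing to compare. For the other topologies, the `T`-embedding and the step function
lie within `embeddingError`, i.e. `max (1/n) |y n - y (n - 1)|`, of each other in `d_T`. This tends
to `0`, and the triangle inequality transfers convergence in both directions.

The estimate is made cell by cell. Over `[k/n, (k+1)/n]` every embedding stays in `{y k, y (k+1)}`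
(J2) or in the segment between these points (M2), and the other embedding, with jumps filled in for
M2, reaches each of these points in the same cell, so only time is lost, at most `1/n`. The last
cell is the exception: `y n` need not be attained, which costs `|y n - y (n - 1)|`.

For M1, both graphs are parametrized along one polygon, with two clocks that differ by at most `1/n`
(`isParamRep_of_J1`). The triangle inequality for `d_{M1}` is not formal, since the middle path
comes with two different representations; `IsParamRep.exists_reparam` reconciles them. -/

/-! ### Grid cells and segments -/

theorem unitInterval.nhdsLT_neBot {t : I} (ht : 0 < t) : (𝓝[<] t).NeBot := by
  rw [← mem_closure_iff_nhdsWithin_neBot, closure_Iio' (a := t) ⟨(0 : I), ht⟩]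
  exact self_mem_Iic

theorem exists_coe_eq_div {n k : ℕ} (hk : k ≤ n) : ∃ a : I, (a : ℝ) = (k : ℝ) / n :=
  ⟨⟨(k : ℝ) / n, by positivity, div_le_one_of_le₀ (by exact_mod_cast hk) (by positivity)⟩, rfl⟩

/-- Cells are open on the left, so that the left limit at `t` is also determined by the cell. -/
theorem exists_grid_cell {n : ℕ} (hn : 1 ≤ n) {t : I} (ht : 0 < t) :
    ∃ k < n, (k : ℝ) / n < t ∧ (t : ℝ) ≤ ((k : ℝ) + 1) / n := by
  have hn0 : (0 : ℝ) < n := by exact_mod_cast hn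
  have ht0 : (0 : ℝ) < t := ht
  have ht1 : (t : ℝ) ≤ 1 := t.2.2
  have hpos : 0 < ⌈(t : ℝ) * n⌉₊ := Nat.ceil_pos.2 (by positivity)
  obtain ⟨k, hk⟩ : ∃ k, ⌈(t : ℝ) * n⌉₊ = k + 1 := ⟨_, (Nat.succ_pred_eq_of_pos hpos).symm⟩
  have h1 : (k : ℝ) < t * n := Nat.lt_ceil.1 (by omega)
  have h2 : (t : ℝ) * n ≤ k + 1 := by exact_mod_cast Nat.ceil_le.1 hk.le
  refine ⟨k, ?_, (div_lt_iff₀ hn0).2 h1, (le_div_iff₀ hn0).2 h2⟩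
  have : (k : ℝ) < n := by nlinarith
  exact_mod_cast this

theorem mem_segment_of_dist_le {E : Type*} [NormedAddCommGroup E] [NormedSpace ℝ E]
    {A B p z q : E} (hp : p ∈ segment ℝ A B) (hz : z ∈ segment ℝ A B) (hq : q ∈ segment ℝ A B)
    (hpz : dist A p ≤ dist A z) (hzq : dist A z ≤ dist A q) : z ∈ segment ℝ p q := by
  rw [segment_eq_image_lineMap] at hp hz hq
  obtain ⟨a, ha, rfl⟩ := hp
  obtain ⟨b, hb, rfl⟩ := hz
  obtain ⟨c, hc, rfl⟩ := hq
  simp only [dist_left_lineMap, Real.norm_of_nonneg ha.1, Real.norm_of_nonneg hb.1,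
    Real.norm_of_nonneg hc.1] at hpz hzq
  rcases eq_or_ne A B with rfl | hAB
  · simp
  · have hd := dist_pos.2 hAB
    have h1 : a ≤ b := le_of_mul_le_mul_right hpz hd
    have h2 : b ≤ c := le_of_mul_le_mul_right hzq hd
    rw [← image_segment, segment_eq_Icc (h1.trans h2)]
    exact mem_image_of_mem _ ⟨h1, h2⟩

theorem eq_of_mem_segment_of_dist_eq {E : Type*} [NormedAddCommGroup E] [NormedSpace ℝ E]
    {A B p q : E} (hp : p ∈ segment ℝ A B) (hq : q ∈ segment ℝ A B)
    (h : dist A p = dist A q) : p = q := by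
  have := mem_segment_of_dist_le hp hq hp h.le h.ge
  rw [segment_same] at this
  exact this.symm

theorem isClosed_segment {d : ℕ} (a b : Rd d) : IsClosed (segment ℝ a b) := by
  rw [segment_eq_image_lineMap]
  exact (isCompact_Icc.image AffineMap.lineMap_continuous).isClosed

/-! ### Left limits and an intermediate value theorem -/

namespace SkorokhodSpace

variable {d : ℕ} (f : SkorokhodSpace d)

theorem tendsto_leftLimit {t : I} (ht : 0 < t) : Tendsto f (𝓝[<] t) (𝓝 (f.leftLimit t)) := by
  have := unitInterval.nhdsLT_neBot ht
  obtain ⟨l, hl⟩ := f.left_lim t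
  rwa [leftLimit, leftLim_eq_of_tendsto hl]

theorem leftLimit_zero : f.leftLimit 0 = f 0 :=
  leftLim_eq_of_eq_bot _ (by simp)

theorem leftLimit_one : f.leftLimit 1 = f 1 := by
  have := unitInterval.nhdsLT_neBot (t := 1) one_pos
  exact leftLim_eq_of_tendsto f.left_cont_one

theorem leftLimit_eq_of_eqOn {a t : I} {g : I → Rd d} (hat : a < t) (hg : ContinuousAt g t)
    (h : ∀ s, a < s → s < t → f s = g s) : f.leftLimit t = g t := by
  have := unitInterval.nhdsLT_neBot (a.2.1.trans_lt hat : (0 : ℝ) < t)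
  refine leftLim_eq_of_tendsto ((hg.tendsto.mono_left nhdsWithin_le_nhds).congr' ?_)
  filter_upwards [Ioo_mem_nhdsLT hat] with s hs using (h s hs.1 hs.2).symm

theorem leftLimit_mem {S : Set (Rd d)} (hS : IsClosed S) {a t : I} (hat : a < t)
    (h : ∀ s, a < s → s < t → f s ∈ S) : f.leftLimit t ∈ S := by
  have ht : 0 < t := (a.2.1.trans_lt hat : (0 : ℝ) < t)
  have := unitInterval.nhdsLT_neBot ht
  refine hS.mem_of_tendsto (f.tendsto_leftLimit ht) ?_
  filter_upwards [Ioo_mem_nhdsLT hat] with s hs using h s hs.1 hs.2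

/-- Intermediate value theorem for a càdlàg path on a segment whose jumps are filled in. -/
theorem exists_mem_segment_leftLimit {a b : I} (hab : a ≤ b)
    (h : ∀ s, a ≤ s → s ≤ b → f s ∈ segment ℝ (f a) (f b)) {z : Rd d}
    (hz : z ∈ segment ℝ (f a) (f b)) : ∃ t, a ≤ t ∧ t ≤ b ∧ (z, t) ∈ f.completeGraph := by
  -- On a segment, position is determined by the distance to the endpoint `f a`. The point `z` is
  -- crossed at the first time `t` at which the path is at least as far out; right continuity puts
  -- `t` itself in `S`.
  set S : Set I := {t | a ≤ t ∧ t ≤ b ∧ dist (f a) z ≤ dist (f a) (f t)} with hS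
  have hzb : dist (f a) z ≤ dist (f a) (f b) := by
    rw [segment_eq_image_lineMap] at hz
    obtain ⟨c, hc, rfl⟩ := hz
    rw [dist_left_lineMap, Real.norm_of_nonneg hc.1]
    exact mul_le_of_le_one_left dist_nonneg hc.2
  have hbS : b ∈ S := ⟨hab, le_rfl, hzb⟩
  set t := sInf S with ht
  have hat : a ≤ t := le_csInf ⟨b, hbS⟩ fun s hs => hs.1
  have htb : t ≤ b := sInf_le hbS
  have hzt : dist (f a) z ≤ dist (f a) (f t) := by
    by_contra! hlt
    have h1 : ∀ᶠ s in 𝓝[>] t, dist (f a) (f s) < dist (f a) z :=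
      (tendsto_const_nhds.dist (f.right_cont t)).eventually_lt_const hlt
    have htb' : t < b := lt_of_le_of_ne htb (by rintro h; rw [h] at hlt; exact hlt.not_ge hzb)
    obtain ⟨u, hu, hu'⟩ := (mem_nhdsGT_iff_exists_Ioo_subset' htb').1 h1
    obtain ⟨s, hs, hsu⟩ := (sInf_lt_iff (s := S)).1 (show sInf S < u from hu)
    rcases (sInf_le hs : t ≤ s).eq_or_lt with h2 | h2
    · exact (h2 ▸ hs.2.2).not_gt hlt
    · exact (hu' ⟨h2, hsu⟩ : dist (f a) (f s) < dist (f a) z).not_ge hs.2.2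
  rcases hat.eq_or_lt with h0 | h0
  · refine ⟨t, hat, htb, ?_⟩
    have hza : z = f a := by
      rw [← h0, dist_self] at hzt
      exact (dist_le_zero.1 hzt).symm
    change z ∈ segment ℝ _ _
    rw [hza, ← h0]
    exact right_mem_segment _ _ _
  · refine ⟨t, hat, htb, ?_⟩
    have ht0 : 0 < t := (a.2.1.trans_lt h0 : (0 : ℝ) < t)
    have hl : f.leftLimit t ∈ segment ℝ (f a) (f b) :=
      f.leftLimit_mem (isClosed_segment _ _) h0 fun s h1 h2 => h s h1.le (h2.le.trans htb)
    -- Before `t` the path is closer to `f a` than `z` is, hence `z` lies between `f(t-)` and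
    -- `f(t)`.
    have hl' : f.leftLimit t ∈ Metric.closedBall (f a) (dist (f a) z) := by
      refine f.leftLimit_mem Metric.isClosed_closedBall h0 fun s h1 h2 => ?_
      rw [mem_closedBall_iff_norm', ← dist_eq_norm]
      by_contra! h3
      exact (sInf_le (show s ∈ S from ⟨h1.le, h2.le.trans htb, h3.le⟩)).not_gt h2
    rw [Metric.mem_closedBall'] at hl'
    exact mem_segment_of_dist_le hl hz (h t hat htb) hl' hzt

end SkorokhodSpace

/-! ### Values of embeddings on a cell -/

namespace IsSkorokhodEmbedding

variable {d n : ℕ} {T : SkorokhodTopology} {y : ℕ → Rd d} {x x' : SkorokhodSpace d}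

theorem eq_zero (h : IsSkorokhodEmbedding T n y x) (hn : 1 ≤ n) : x 0 = y 0 :=
  h.at_grid 0 hn 0 (by simp)

/-- Closedness of `S k` passes from the open cell to left limits. At the right end the value is `y
(k + 1)`, except at time `1`, where it equals the left limit; so nothing is asked of `y n`. -/
theorem mem_of_cell (h : IsSkorokhodEmbedding T n y x) {S : ℕ → Set (Rd d)}
    (hS : ∀ k < n, IsClosed (S k)) (h1 : ∀ k, k + 1 < n → y (k + 1) ∈ S k)
    (hr : ∀ k < n, ∀ t z, EmbeddingRule T n y k t z → z ∈ S k) {k : ℕ} (hk : k < n)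
    {t : I} (ht : (k : ℝ) / n < t) (ht' : (t : ℝ) ≤ ((k : ℝ) + 1) / n) :
    x.leftLimit t ∈ S k ∧ x t ∈ S k := by
  have hn0 : (0 : ℝ) < n := by exact_mod_cast (Nat.zero_le k).trans_lt hk
  obtain ⟨a, ha⟩ := exists_coe_eq_div hk.le
  have hl : x.leftLimit t ∈ S k := by
    refine x.leftLimit_mem (hS k hk) (a := a) (by rw [← Subtype.coe_lt_coe, ha]; exact ht)
      fun s h2 h3 => hr k hk s _ (h.between k hk s ?_ ?_)
    · rw [← ha]; exact h2
    · exact (Subtype.coe_lt_coe.2 h3).trans_le ht'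
  refine ⟨hl, ?_⟩
  rcases ht'.lt_or_eq with h2 | h2
  · exact hr k hk t _ (h.between k hk t ht h2)
  · rcases Nat.lt_or_ge (k + 1) n with h3 | h3
    · rw [h.at_grid (k + 1) h3 t (by rw [h2]; push_cast; ring)]
      exact h1 k h3
    · have : t = 1 := by
        have h4 : (k : ℝ) + 1 = n := by exact_mod_cast (show k + 1 = n by omega)
        rw [h4, div_self hn0.ne'] at h2
        exact Subtype.ext h2
      rw [this] at hl ⊢
      rwa [x.leftLimit_one] at hl

theorem exists_cell (h : IsSkorokhodEmbedding T n y x) (hn : 1 ≤ n) {S : ℕ → Set (Rd d)}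
    (hS : ∀ k < n, IsClosed (S k))
    (h0 : ∀ k < n, y k ∈ S k) (h1 : ∀ k, k + 1 < n → y (k + 1) ∈ S k)
    (hr : ∀ k < n, ∀ t z, EmbeddingRule T n y k t z → z ∈ S k) (t : I) :
    ∃ k < n, (k : ℝ) / n ≤ t ∧ (t : ℝ) ≤ ((k : ℝ) + 1) / n ∧
      x.leftLimit t ∈ S k ∧ x t ∈ S k := by
  rcases (unitInterval.nonneg' : 0 ≤ t).eq_or_lt with rfl | ht
  · refine ⟨0, hn, by simp, by simp, ?_⟩
    rw [x.leftLimit_zero, h.eq_zero hn]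
    exact ⟨h0 0 hn, h0 0 hn⟩
  · obtain ⟨k, hk, h2, h3⟩ := exists_grid_cell hn ht
    exact ⟨k, hk, h2.le, h3, h.mem_of_cell hS h1 hr hk h2 h3⟩

theorem toJ2 (h : IsSkorokhodEmbedding .J1 n y x) : IsSkorokhodEmbedding .J2 n y x :=
  ⟨h.at_grid, fun k hk t h1 h2 => Or.inl (h.between k hk t h1 h2)⟩

theorem toM2 (h : IsSkorokhodEmbedding .J1 n y x) : IsSkorokhodEmbedding .M2 n y x := by
  refine ⟨h.at_grid, fun k hk t h1 h2 => ?_⟩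
  rw [show x t = y k from h.between k hk t h1 h2]
  exact left_mem_segment _ _ _

theorem apply_of_J1 (h : IsSkorokhodEmbedding .J1 n y x) {k : ℕ} (hk : k < n) {t : I}
    (ht : (k : ℝ) / n ≤ t) (ht' : (t : ℝ) < ((k : ℝ) + 1) / n) : x t = y k := by
  rcases ht.eq_or_lt with h1 | h1
  · exact h.at_grid k hk t h1.symm
  · exact h.between k hk t h1 ht'

theorem leftLimit_of_J1 (h : IsSkorokhodEmbedding .J1 n y x) {k : ℕ} (hk : k < n) {t : I}
    (ht : (k : ℝ) / n < t) (ht' : (t : ℝ) ≤ ((k : ℝ) + 1) / n) : x.leftLimit t = y k := by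
  obtain ⟨a, ha⟩ := exists_coe_eq_div hk.le
  refine x.leftLimit_eq_of_eqOn (a := a) (g := fun _ => y k)
    (by rw [← Subtype.coe_lt_coe, ha]; exact ht) continuousAt_const
    fun s h2 h3 => h.between k hk s ?_ ?_
  · rw [← ha]; exact h2
  · exact (Subtype.coe_lt_coe.2 h3).trans_le ht'

theorem apply_one_of_J1 (h : IsSkorokhodEmbedding .J1 n y x) (hn : 1 ≤ n) :
    x 1 = y (n - 1) := by
  have hn0 : (0 : ℝ) < n := by exact_mod_cast hn
  rw [← x.leftLimit_one]
  refine h.leftLimit_of_J1 (Nat.sub_lt hn one_pos) ?_ ?_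
  · rw [Nat.cast_sub hn, div_lt_iff₀ hn0]; simp
  · rw [Nat.cast_sub hn, le_div_iff₀ hn0]; simp

theorem eq_of_J1 (h : IsSkorokhodEmbedding .J1 n y x) (h' : IsSkorokhodEmbedding .J1 n y x')
    (hn : 1 ≤ n) : x = x' := by
  have : x.toFun = x'.toFun := by
    funext t
    rcases (unitInterval.nonneg' : 0 ≤ t).eq_or_lt with rfl | ht
    · rw [h.eq_zero hn, h'.eq_zero hn]
    obtain ⟨k, hk, h2, h3⟩ := exists_grid_cell hn ht
    rcases h3.lt_or_eq with h4 | h4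
    · rw [h.apply_of_J1 hk h2.le h4, h'.apply_of_J1 hk h2.le h4]
    rcases Nat.lt_or_ge (k + 1) n with h5 | h5
    · have h6 : (t : ℝ) = ((k + 1 : ℕ) : ℝ) / n := by rw [h4]; push_cast; ring
      rw [h.at_grid _ h5 t h6, h'.at_grid _ h5 t h6]
    · have : t = 1 := by
        have h6 : (k : ℝ) + 1 = n := by exact_mod_cast (show k + 1 = n by omega)
        have hn0 : (0 : ℝ) < n := by exact_mod_cast hn
        rw [h6, div_self hn0.ne'] at h4
        exact Subtype.ext h4
      rw [this, h.apply_one_of_J1 hn, h'.apply_one_of_J1 hn]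
  cases x; cases x'; congr

end IsSkorokhodEmbedding

/-! ### Hausdorff estimates for J2 and M2 -/

/-- The distance of two embeddings of the same discrete path is at most this number. -/
noncomputable def embeddingError {d : ℕ} (n : ℕ) (y : ℕ → Rd d) : ℝ :=
  max (1 / (n : ℝ)) (dist (y n) (y (n - 1)))

theorem dist_le_one_div_of_cell {n k : ℕ} {s t : I} (hs : (k : ℝ) / n ≤ s)
    (hs' : (s : ℝ) ≤ ((k : ℝ) + 1) / n) (ht : (k : ℝ) / n ≤ t)
    (ht' : (t : ℝ) ≤ ((k : ℝ) + 1) / n) : dist s t ≤ 1 / n := by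
  rw [add_div] at hs' ht'
  rw [Subtype.dist_eq, Real.dist_eq, abs_le]
  constructor <;> linarith

theorem edist_prod_le_ofReal {d : ℕ} {z w : Rd d} {s t : I} {c : ℝ} (h : dist z w ≤ c)
    (h' : dist s t ≤ c) : edist (z, s) (w, t) ≤ ENNReal.ofReal c := by
  rw [edist_dist, Prod.dist_eq]
  exact ENNReal.ofReal_le_ofReal (max_le h h')

namespace IsSkorokhodEmbedding

variable {d n : ℕ} {T : SkorokhodTopology} {y : ℕ → Rd d} {x x' : SkorokhodSpace d}

theorem exists_mem_graph_of_J2 (h : IsSkorokhodEmbedding .J2 n y x)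
    (h' : IsSkorokhodEmbedding .J2 n y x') (hn : 1 ≤ n) :
    ∀ p ∈ x.graph, ∃ q ∈ x'.graph, edist p q ≤ ENNReal.ofReal (embeddingError n y) := by
  rintro ⟨z, t⟩ hp
  obtain ⟨k, hk, h1, h2, h3, h4⟩ := h.exists_cell hn (S := fun k => {y k, y (k + 1)})
    (fun k _ => (Set.toFinite _).isClosed) (by simp) (by simp) (fun k _ t z hz => hz) t
  have hz : z = y k ∨ z = y (k + 1) := by
    rcases hp with hp | hp
    · rw [show z = _ from hp]; exact h3
    · rw [show z = _ from hp]; exact h4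
  obtain ⟨a, ha⟩ := exists_coe_eq_div hk.le
  have ha' : x' a = y k := h'.at_grid k hk a ha
  have hat : dist t a ≤ 1 / n :=
    dist_le_one_div_of_cell h1 h2 ha.ge (by rw [ha]; gcongr; simp)
  have key : dist z (y k) ≤ embeddingError n y → ∃ q ∈ x'.graph,
      edist (z, t) q ≤ ENNReal.ofReal (embeddingError n y) := fun hd =>
    ⟨(y k, a), Or.inr ha'.symm, edist_prod_le_ofReal hd (hat.trans (le_max_left _ _))⟩
  have herr : 0 ≤ embeddingError n y := dist_nonneg.trans (le_max_right _ _)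
  rcases hz with rfl | rfl
  · exact key (by rwa [dist_self])
  rcases Nat.lt_or_ge (k + 1) n with h5 | h5
  · obtain ⟨b, hb⟩ := exists_coe_eq_div h5.le
    refine ⟨(y (k + 1), b), Or.inr (h'.at_grid _ h5 b hb).symm,
      edist_prod_le_ofReal (by rwa [dist_self]) ((dist_le_one_div_of_cell h1 h2 ?_ ?_).trans
        (le_max_left _ _))⟩
    · rw [hb]; gcongr; simp
    · rw [hb]; push_cast; rfl
  -- In the last cell `x'` may miss `y n`; the point is matched with `y (n - 1)` instead.
  · obtain rfl : n = k + 1 := by omega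
    exact key (le_max_right _ _)

theorem exists_mem_completeGraph_of_M2 (h : IsSkorokhodEmbedding .M2 n y x)
    (h' : IsSkorokhodEmbedding .M2 n y x') (hn : 1 ≤ n) :
    ∀ p ∈ x.completeGraph, ∃ q ∈ x'.completeGraph,
      edist p q ≤ ENNReal.ofReal (embeddingError n y) := by
  rintro ⟨z, t⟩ hp
  obtain ⟨k, hk, h1, h2, h3, h4⟩ := h.exists_cell hn (S := fun k => segment ℝ (y k) (y (k + 1)))
    (fun k _ => isClosed_segment _ _) (fun k _ => left_mem_segment _ _ _)
    (fun k _ => right_mem_segment _ _ _) (fun k _ t z hz => hz) t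
  have hz : z ∈ segment ℝ (y k) (y (k + 1)) := (convex_segment _ _).segment_subset h3 h4 hp
  have herr : 0 ≤ embeddingError n y := dist_nonneg.trans (le_max_right _ _)
  obtain ⟨a, ha⟩ := exists_coe_eq_div hk.le
  have ha' : x' a = y k := h'.at_grid k hk a ha
  rcases Nat.lt_or_ge (k + 1) n with h5 | h5
  · obtain ⟨b, hb⟩ := exists_coe_eq_div h5.le
    have hb' : x' b = y (k + 1) := h'.at_grid _ h5 b hb
    have hab : a ≤ b := by
      rw [← Subtype.coe_le_coe, ha, hb]; gcongr; simp
    push_cast at hb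
    -- `x'` runs from `y k` to `y (k + 1)` inside their segment, so its completed graph passes
    -- through `z` within the cell.
    obtain ⟨s, hs, hs', hsz⟩ := x'.exists_mem_segment_leftLimit hab (z := z) (by
      intro s hs hs'
      rw [ha', hb']
      rcases hs.eq_or_lt with rfl | hs
      · rw [ha']; exact left_mem_segment _ _ _
      · exact (h'.mem_of_cell (S := fun k => segment ℝ (y k) (y (k + 1)))
          (fun k _ => isClosed_segment _ _) (fun k _ => right_mem_segment _ _ _)
          (fun k _ t z hz => hz) hk (by rw [← ha]; exact hs) (by rw [← hb]; exact hs')).2)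
      (by rwa [ha', hb'])
    exact ⟨(z, s), hsz, edist_prod_le_ofReal (by rwa [dist_self]) ((dist_le_one_div_of_cell h1 h2
      (by rw [← ha]; exact hs) (by rw [← hb]; exact hs')).trans (le_max_left _ _))⟩
  · obtain rfl : n = k + 1 := by omega
    refine ⟨(y k, a), ?_, edist_prod_le_ofReal ?_ ((dist_le_one_div_of_cell h1 h2 ha.ge
      (by rw [ha]; gcongr; simp)).trans (le_max_left _ _))⟩
    · change y k ∈ segment ℝ _ _
      rw [ha']; exact right_mem_segment _ _ _
    · refine le_trans ?_ (le_max_right _ _)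
      rw [segment_eq_image_lineMap] at hz
      obtain ⟨c, hc, rfl⟩ := hz
      rw [dist_lineMap_left, Real.norm_of_nonneg hc.1, dist_comm]
      exact mul_le_of_le_one_left dist_nonneg hc.2

theorem distJ2_le (h : IsSkorokhodEmbedding .J2 n y x)
    (h' : IsSkorokhodEmbedding .J2 n y x') (hn : 1 ≤ n) :
    x.distJ2 x' ≤ ENNReal.ofReal (embeddingError n y) := by
  refine Metric.hausdorffEDist_le_of_mem_edist (h.exists_mem_graph_of_J2 h' hn)
    (h'.exists_mem_graph_of_J2 h hn)

theorem distM2_le (h : IsSkorokhodEmbedding .M2 n y x)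
    (h' : IsSkorokhodEmbedding .M2 n y x') (hn : 1 ≤ n) :
    x.distM2 x' ≤ ENNReal.ofReal (embeddingError n y) := by
  refine Metric.hausdorffEDist_le_of_mem_edist (h.exists_mem_completeGraph_of_M2 h' hn)
    (h'.exists_mem_completeGraph_of_M2 h hn)

end IsSkorokhodEmbedding

/-! ### Parametric representations and the triangle inequality for M1 -/

namespace SkorokhodSpace

variable {d : ℕ} {f g h : SkorokhodSpace d}

theorem graphLE_antisymm {p q : Rd d × I} (hp : p ∈ f.completeGraph) (hq : q ∈ f.completeGraph)
    (hpq : f.graphLE p q) (hqp : f.graphLE q p) : p = q := by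
  obtain ⟨z, s⟩ := p
  obtain ⟨w, t⟩ := q
  rcases hpq with h1 | ⟨h1, h2⟩
  · rcases hqp with h3 | ⟨h3, -⟩
    · exact absurd h1 (lt_asymm h3)
    · exact absurd h3 h1.ne'
  rcases hqp with h3 | ⟨-, h4⟩
  · exact absurd h1 h3.ne'
  dsimp only at h1 h2 h4
  subst h1
  rw [show z = w from eq_of_mem_segment_of_dist_eq hp hq (le_antisymm h2 h4)]

namespace IsParamRep

variable {u u' : I → Rd d} {r r' : I → I}

theorem mem (h : f.IsParamRep u r) (s : I) : (u s, r s) ∈ f.completeGraph :=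
  h.range_eq ▸ mem_range_self s

theorem comp (h : f.IsParamRep u r) {b : I → I} (hb : Continuous b) (hm : Monotone b)
    (hs : Function.Surjective b) : f.IsParamRep (u ∘ b) (r ∘ b) where
  cont_u := h.cont_u.comp hb
  cont_r := h.cont_r.comp hb
  range_eq := by
    rw [← h.range_eq]
    exact hs.range_comp fun s => (u s, r s)
  mono s t hst := h.mono _ _ (hm hst)

/-- The first time at which the second representation passes through a point of the first depends
monotonically on that point. -/
theorem exists_monotone_eq (h : f.IsParamRep u r) (h' : f.IsParamRep u' r') :
    ∃ τ : I → I, Monotone τ ∧ ∀ s, u' (τ s) = u s ∧ r' (τ s) = r s := by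
  set F : I → Set I := fun s => {t | (u' t, r' t) = (u s, r s)} with hF
  have hne (s) : (F s).Nonempty := by
    have := h.mem s
    rwa [← h'.range_eq] at this
  have hcl (s) : IsClosed (F s) :=
    isClosed_eq (h'.cont_u.prodMk h'.cont_r) continuous_const
  have hmem (s) : (u' (sInf (F s)), r' (sInf (F s))) = (u s, r s) := (hcl s).sInf_mem (hne s)
  refine ⟨fun s => sInf (F s), fun s t hst => ?_, fun s => Prod.mk.inj (hmem s)⟩
  by_contra! hlt
  have h1 := h'.mono _ _ hlt.le
  rw [hmem, hmem] at h1
  -- If the order of the hitting times were reversed, the two points would coincide, and then so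
  -- would their first hitting times.
  have h2 := graphLE_antisymm (h.mem s) (h.mem t) (h.mono s t hst) h1
  simp only [hF, h2, lt_irrefl] at hlt

end IsParamRep

end SkorokhodSpace

/-- Moving average of a monotone function. -/
theorem exists_continuous_monotone_between {τ : ℝ → ℝ} (hτ : Monotone τ) {δ : ℝ} (hδ : 0 < δ) :
    ∃ β : ℝ → ℝ, Continuous β ∧ Monotone β ∧ ∀ x, β x ∈ Icc (τ x) (τ (x + δ)) := by
  have hint (a b : ℝ) : IntervalIntegrable τ MeasureTheory.volume a b := hτ.intervalIntegrable
  have hint' (x a b : ℝ) : IntervalIntegrable (fun v => τ (x + v)) MeasureTheory.volume a b :=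
    (hτ.comp fun a b hab => add_le_add_right hab x).intervalIntegrable
  have hc (c : ℝ) : δ⁻¹ * ∫ _ in (0 : ℝ)..δ, c = c := by
    simp [hδ.ne']
  refine ⟨fun x => δ⁻¹ * ∫ v in (0 : ℝ)..δ, τ (x + v), ?_, fun x x' hx => ?_, fun x => ⟨?_, ?_⟩⟩
  -- The average is continuous even where `τ` jumps, being a difference of primitives.
  · have h1 : (fun x : ℝ => ∫ v in (0 : ℝ)..δ, τ (x + v)) =
        fun x => (∫ v in (0 : ℝ)..(x + δ), τ v) - ∫ v in (0 : ℝ)..x, τ v := by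
      funext x
      rw [intervalIntegral.integral_interval_sub_left (hint _ _) (hint _ _)]
      simp
    have h2 := intervalIntegral.continuous_primitive hint 0
    refine continuous_const.mul ?_
    rw [h1]
    exact (h2.comp (continuous_add_const δ)).sub h2
  · refine mul_le_mul_of_nonneg_left ?_ (by positivity)
    exact intervalIntegral.integral_mono_on hδ.le (hint' _ _ _) (hint' _ _ _)
      fun v _ => hτ (by linarith)
  · rw [← hc (τ x)]
    refine mul_le_mul_of_nonneg_left ?_ (by positivity)
    exact intervalIntegral.integral_mono_on hδ.le (by simp) (hint' _ _ _)
      fun v hv => hτ (by linarith [hv.1])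
  · rw [← hc (τ (x + δ))]
    refine mul_le_mul_of_nonneg_left ?_ (by positivity)
    exact intervalIntegral.integral_mono_on hδ.le (hint' _ _ _) (by simp)
      fun v hv => hτ (by linarith [hv.2])

/-- A monotone self-map of the unit interval can be smoothed into a continuous monotone
surjection, up to a small shift of the argument. -/
theorem unitInterval.exists_continuous_surjective_between {τ : I → I} (hτ : Monotone τ) {δ : ℝ}
    (hδ : 0 < δ) : ∃ β : I → I, Continuous β ∧ Monotone β ∧ Function.Surjective β ∧
      ∀ s : I, ∃ x : ℝ, |x - s| ≤ 2 * δ ∧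
        (∀ a : I, a ≤ x → τ a ≤ β s) ∧ ∀ a : I, x + δ ≤ a → β s ≤ τ a := by
  -- The extension by `0` and `1` makes the average take both extreme values, which gives
  -- surjectivity.
  set e : ℝ → ℝ := fun x => if x < 0 then 0 else if 1 < x then 1 else τ (projIcc 0 1 zero_le_one x)
    with he
  have h0 (x : ℝ) (hx : x < 0) : e x = 0 := if_pos hx
  have h1 (x : ℝ) (hx : 1 < x) : e x = 1 := by
    simp only [he]
    rw [if_neg (by linarith), if_pos hx]
  have h2 (a : I) : e a = τ a := by
    simp only [he]
    rw [if_neg (not_lt.2 a.2.1), if_neg (not_lt.2 a.2.2), projIcc_val]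
  have hm : Monotone e := by
    intro x x' hx
    simp only [he]
    split_ifs <;> first | linarith | exact (τ _).2.1 | exact (τ _).2.2 |
      exact hτ (monotone_projIcc _ hx)
  have he01 (x : ℝ) : e x ∈ Icc (0 : ℝ) 1 := by
    simp only [he]
    split_ifs <;> first | exact (τ _).2 | simp
  obtain ⟨b, hbc, hbm, hb⟩ := exists_continuous_monotone_between hm hδ
  have hb01 (x : ℝ) : b x ∈ Icc (0 : ℝ) 1 :=
    ⟨(he01 _).1.trans (hb x).1, (hb x).2.trans (he01 _).2⟩
  -- `α` stretches `[0,1]` onto `[-2δ, 1+δ]`: the averaging windows of length `δ` at the two ends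
  -- lie entirely outside `[0,1]`, and no point moves by more than `2δ`.
  set α : I → ℝ := fun s => -(2 * δ) + (1 + 3 * δ) * s with hα
  have hαm : Monotone α := fun s t hst => by
    have : (s : ℝ) ≤ t := hst
    simp only [hα]
    gcongr
  have hαc : Continuous α := by fun_prop
  have hβc : Continuous (fun s => (⟨b (α s), hb01 _⟩ : I)) := (hbc.comp hαc).subtype_mk _
  refine ⟨fun s => ⟨b (α s), hb01 _⟩, hβc, fun s t hst => hbm (hαm hst), fun t => ?_,
    fun s => ⟨α s, ?_, fun a ha => ?_, fun a ha => ?_⟩⟩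
  · have hβ0 : b (α 0) = 0 := by
      refine le_antisymm ((hb _).2.trans ?_) (hb01 _).1
      rw [h0 _ (by simp [hα]; linarith)]
    have hβ1 : b (α 1) = 1 := by
      refine le_antisymm (hb01 _).2 (le_trans ?_ (hb _).1)
      rw [h1 _ (by simp [hα]; linarith)]
    refine mem_range_of_exists_le_of_exists_ge hβc ⟨0, ?_⟩ ⟨1, ?_⟩
    · rw [← Subtype.coe_le_coe]; exact hβ0.le.trans t.2.1
    · rw [← Subtype.coe_le_coe]; exact t.2.2.trans hβ1.ge
  · have := s.2.1
    have := s.2.2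
    rw [abs_le]
    constructor <;> simp only [hα] <;> nlinarith
  · rw [← Subtype.coe_le_coe, ← h2]
    exact (hm ha).trans (hb _).1
  · rw [← Subtype.coe_le_coe, ← h2]
    exact (hb _).2.trans (hm ha)

namespace SkorokhodSpace

variable {d : ℕ} {f g h : SkorokhodSpace d}

/-- Two parametric representations of the same graph agree up to a small error after a
continuous change of parameter. -/
theorem IsParamRep.exists_reparam {u u' : I → Rd d} {r r' : I → I} (h : f.IsParamRep u r)
    (h' : f.IsParamRep u' r') {ε : ℝ} (hε : 0 < ε) :
    ∃ β : I → I, Continuous β ∧ Monotone β ∧ Function.Surjective β ∧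
      ∀ s, dist (u s) (u' (β s)) ≤ ε ∧ dist (r s) (r' (β s)) ≤ ε := by
  obtain ⟨τ, hτm, hτ⟩ := h.exists_monotone_eq h'
  obtain ⟨δ, hδ, hunif⟩ := Metric.uniformContinuous_iff.1
    (CompactSpace.uniformContinuous_of_continuous (h.cont_u.prodMk h.cont_r)) ε hε
  obtain ⟨β, hβc, hβm, hβs, hβ⟩ :=
    unitInterval.exists_continuous_surjective_between hτm (show 0 < δ / 4 by positivity)
  refine ⟨β, hβc, hβm, hβs, fun s => ?_⟩
  -- It is enough that the first representation visits the point at `β s` at a parameter near `s`: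
  -- the shift `2 * (δ / 4)` plus the window `δ / 4` stays below `δ`.
  suffices hs : ∃ a : I, |(a : ℝ) - s| ≤ 3 * (δ / 4) ∧ (u a, r a) = (u' (β s), r' (β s)) by
    obtain ⟨a, ha, hpa⟩ := hs
    have := hunif (a := s) (b := a) (by
      rw [dist_comm, Subtype.dist_eq, Real.dist_eq]; linarith)
    rw [hpa, Prod.dist_eq, max_lt_iff] at this
    exact ⟨this.1.le, this.2.le⟩
  obtain ⟨x, hx, hx1, hx2⟩ := hβ s
  obtain ⟨c, hc⟩ : ∃ c, (u c, r c) = (u' (β s), r' (β s)) := by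
    have := h'.mem (β s)
    rwa [← h.range_eq] at this
  have hp (a : I) : (u' (τ a), r' (τ a)) = (u a, r a) := Prod.ext (hτ a).1 (hτ a).2
  have hs0 := s.2.1
  have hs1 := s.2.2
  have hc0 := c.2.1
  have hc1 := c.2.2
  rw [abs_le] at hx
  -- The visiting time `c` may be far from `s`. If `c < x`, then the point at `x` (cut off at `1`)
  -- lies between the point at `c` and the point at `β s`, which are equal; so `x` serves as well.
  -- The case `c > x + δ / 4` is symmetric, and otherwise `c` is already close.
  rcases lt_or_ge (c : ℝ) x with hcx | hcx
  · have ha : (min x 1 : ℝ) ∈ Icc (0 : ℝ) 1 := ⟨le_min (by linarith) zero_le_one, min_le_right _ _⟩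
    refine ⟨⟨min x 1, ha⟩, ?_, ?_⟩
    · rw [abs_le]
      constructor <;> dsimp only <;> rcases min_cases x 1 with h | h <;> rw [h.1] <;> linarith
    · rw [← hc]
      refine graphLE_antisymm (h.mem _) (h.mem _) ?_ (h.mono c _ ?_)
      · rw [hc, ← hp]
        exact h'.mono _ _ (hx1 _ (min_le_left _ _))
      · exact Subtype.coe_le_coe.1 (le_min hcx.le hc1)
  rcases lt_or_ge (x + δ / 4) (c : ℝ) with hcx' | hcx'
  · have ha : (max (x + δ / 4) 0 : ℝ) ∈ Icc (0 : ℝ) 1 :=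
      ⟨le_max_right _ _, max_le (by linarith) zero_le_one⟩
    refine ⟨⟨max (x + δ / 4) 0, ha⟩, ?_, ?_⟩
    · rw [abs_le]
      constructor <;> dsimp only <;> rcases max_cases (x + δ / 4) 0 with h | h <;> rw [h.1] <;>
        linarith
    · rw [← hc]
      refine graphLE_antisymm (h.mem _) (h.mem _) (h.mono _ c ?_) ?_
      · exact Subtype.coe_le_coe.1 (max_le hcx'.le hc0)
      · rw [hc, ← hp]
        exact h'.mono _ _ (hx2 ⟨max (x + δ / 4) 0, ha⟩ (le_max_left _ _))
  · refine ⟨c, ?_, hc⟩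
    rw [abs_le]
    constructor <;> linarith

theorem distM1_le {u₁ u₂ : I → Rd d} {r₁ r₂ : I → I} (h₁ : f.IsParamRep u₁ r₁)
    (h₂ : g.IsParamRep u₂ r₂) {c : ℝ≥0∞} (hu : ∀ t, edist (u₁ t) (u₂ t) ≤ c)
    (hr : ∀ t, edist (r₁ t) (r₂ t) ≤ c) : f.distM1 g ≤ c := by
  refine le_trans ?_ (sup_le (iSup_le hu) (iSup_le hr))
  exact iInf_le_of_le u₁ (iInf_le_of_le r₁ (iInf_le_of_le u₂ (iInf_le_of_le r₂
    (iInf_le_of_le ⟨h₁, h₂⟩ le_rfl))))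

theorem exists_of_distM1_lt {c : ℝ≥0∞} (h : f.distM1 g < c) :
    ∃ u₁ r₁ u₂ r₂, f.IsParamRep u₁ r₁ ∧ g.IsParamRep u₂ r₂ ∧
      (∀ t, edist (u₁ t) (u₂ t) ≤ c) ∧ ∀ t, edist (r₁ t) (r₂ t) ≤ c := by
  simp only [distM1, iInf_lt_iff] at h
  obtain ⟨u₁, r₁, u₂, r₂, ⟨h₁, h₂⟩, h⟩ := h
  have h := sup_le_iff.1 h.le
  exact ⟨u₁, r₁, u₂, r₂, h₁, h₂, iSup_le_iff.1 h.1, iSup_le_iff.1 h.2⟩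

/-- Near-optimal pairs for `(f, g)` and `(g, h)` use different representations of `g`.
Reparametrizing the second pair aligns them up to `ε / 3`; the other two thirds pay for
near-optimality. -/
theorem distM1_triangle (f g h : SkorokhodSpace d) :
    f.distM1 h ≤ f.distM1 g + g.distM1 h := by
  refine ENNReal.le_of_forall_pos_le_add fun ε hε hfin => ?_
  obtain ⟨hfin1, hfin2⟩ := ENNReal.add_lt_top.1 hfin
  have hε3 : (0 : ℝ) < ε / 3 := by positivity
  have hε3' : ENNReal.ofReal (ε / 3) ≠ 0 := by simpa using hε
  obtain ⟨u₁, r₁, u₂, r₂, h₁, h₂, hu, hr⟩ :=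
    exists_of_distM1_lt (ENNReal.lt_add_right hfin1.ne hε3')
  obtain ⟨u₂', r₂', u₃, r₃, h₂', h₃, hu', hr'⟩ :=
    exists_of_distM1_lt (ENNReal.lt_add_right hfin2.ne hε3')
  obtain ⟨β, hβc, hβm, hβs, hβ⟩ := h₂.exists_reparam h₂' hε3
  have hsum : f.distM1 g + ENNReal.ofReal (ε / 3) + ENNReal.ofReal (ε / 3) +
      (g.distM1 h + ENNReal.ofReal (ε / 3)) = f.distM1 g + g.distM1 h + ε := by
    have : (ε : ℝ≥0∞) =
        ENNReal.ofReal (ε / 3) + ENNReal.ofReal (ε / 3) + ENNReal.ofReal (ε / 3) := by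
      rw [← ENNReal.ofReal_add hε3.le hε3.le, ← ENNReal.ofReal_add (by positivity) hε3.le,
        ← ENNReal.ofReal_coe_nnreal]
      congr 1
      ring
    rw [this]
    ring
  rw [← hsum]
  refine distM1_le h₁ (h₃.comp hβc hβm hβs) (fun t => ?_) fun t => ?_
  · refine (edist_triangle4 _ (u₂ t) (u₂' (β t)) _).trans (add_le_add (add_le_add (hu t) ?_) (hu' _))
    rw [edist_dist]
    exact ENNReal.ofReal_le_ofReal (hβ t).1
  · refine (edist_triangle4 _ (r₂ t) (r₂' (β t)) _).trans (add_le_add (add_le_add (hr t) ?_) (hr' _))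
    rw [edist_dist]
    exact ENNReal.ofReal_le_ofReal (hβ t).2

end SkorokhodSpace

/-! ### The two clocks -/

/-- Deviation, within a unit cell, of the clock that rests on the first half from the identity. -/
noncomputable def clockShift (θ : ℝ) : ℝ := max 0 (2 * θ - 1) - θ

/-- The clock that rests on the first half of every unit cell and runs on the second half. -/
noncomputable def lateClock (w : ℝ) : ℝ := w + clockShift (Int.fract w)

/-- The clock that runs on the first half of every unit cell and rests on the second half. -/
noncomputable def earlyClock (w : ℝ) : ℝ := w - clockShift (Int.fract w)

/-- `clockShift` takes the same value at `0` and `1`, so its periodic extension has no jumps. -/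
theorem continuous_clockShift_fract : Continuous fun w : ℝ => clockShift (Int.fract w) := by
  have : Continuous clockShift := by unfold clockShift; fun_prop
  exact this.continuousOn.comp_fract'' (by norm_num [clockShift])

theorem continuous_lateClock : Continuous lateClock :=
  continuous_id.add continuous_clockShift_fract

theorem continuous_earlyClock : Continuous earlyClock :=
  continuous_id.sub continuous_clockShift_fract

theorem lateClock_eq (w : ℝ) : lateClock w = ⌊w⌋ + max 0 (2 * Int.fract w - 1) := by
  have := Int.floor_add_fract w
  simp only [lateClock, clockShift]
  linarith

theorem earlyClock_eq (w : ℝ) : earlyClock w = ⌊w⌋ + min 1 (2 * Int.fract w) := by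
  have := Int.floor_add_fract w
  have h2 : max 0 (2 * Int.fract w - 1) + min 1 (2 * Int.fract w) = 2 * Int.fract w := by
    rcases le_total (2 * Int.fract w) 1 with h | h
    · rw [max_eq_left (by linarith), min_eq_right h]; ring
    · rw [max_eq_right (by linarith), min_eq_left h]; ring
  simp only [earlyClock, clockShift]
  linarith

theorem monotone_of_floor_cell {F : ℝ → ℝ} {G : ℝ → ℝ} (hG : Monotone G)
    (hG01 : ∀ θ ∈ Ico (0 : ℝ) 1, G θ ∈ Icc (0 : ℝ) 1)
    (hF : ∀ w, F w = ⌊w⌋ + G (Int.fract w)) : Monotone F := by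
  intro w w' hw
  have h1 := hG01 _ ⟨Int.fract_nonneg w, Int.fract_lt_one w⟩
  have h2 := hG01 _ ⟨Int.fract_nonneg w', Int.fract_lt_one w'⟩
  rw [hF, hF]
  rcases (Int.floor_mono hw).eq_or_lt with h | h
  · rw [h]
    gcongr
    apply hG
    rw [Int.fract, Int.fract, h]
    linarith
  · have : (⌊w⌋ : ℝ) + 1 ≤ ⌊w'⌋ := by exact_mod_cast h
    linarith [h1.2, h2.1]

theorem monotone_lateClock : Monotone lateClock :=
  monotone_of_floor_cell (G := fun θ => max 0 (2 * θ - 1))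
    (fun _ _ h => max_le_max le_rfl (by linarith))
    (fun _ h => ⟨le_max_left _ _, max_le zero_le_one (by linarith [h.2])⟩) lateClock_eq

theorem monotone_earlyClock : Monotone earlyClock :=
  monotone_of_floor_cell (G := fun θ => min 1 (2 * θ))
    (fun _ _ h => min_le_min le_rfl (by linarith))
    (fun _ h => ⟨le_min zero_le_one (by linarith [h.1]), min_le_left _ _⟩) earlyClock_eq

theorem lateClock_natCast (k : ℕ) : lateClock k = k := by simp [lateClock_eq]

theorem earlyClock_natCast (k : ℕ) : earlyClock k = k := by simp [earlyClock_eq]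

theorem clock_of_le_half {k : ℕ} {w : ℝ} (h : (k : ℝ) ≤ w) (h' : w ≤ k + 1 / 2) :
    lateClock w = k ∧ earlyClock w = 2 * w - k := by
  have hf : ⌊w⌋ = (k : ℤ) := Int.floor_eq_iff.2 ⟨by exact_mod_cast h, by push_cast; linarith⟩
  have hfr : Int.fract w = w - k := by rw [Int.fract, hf]; simp
  rw [lateClock_eq, earlyClock_eq, hf, hfr, max_eq_left (by linarith), min_eq_right (by linarith)]
  push_cast
  constructor <;> ring

theorem clock_of_half_le {k : ℕ} {w : ℝ} (h : (k : ℝ) + 1 / 2 ≤ w) (h' : w ≤ k + 1) :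
    lateClock w = 2 * w - k - 1 ∧ earlyClock w = k + 1 := by
  rcases h'.eq_or_lt with rfl | h'
  · have h1 := lateClock_natCast (k + 1)
    have h2 := earlyClock_natCast (k + 1)
    push_cast at h1 h2
    rw [h1, h2]
    constructor <;> ring
  have hf : ⌊w⌋ = (k : ℤ) := Int.floor_eq_iff.2 ⟨by push_cast; linarith, by push_cast; linarith⟩
  have hfr : Int.fract w = w - k := by rw [Int.fract, hf]; simp
  rw [lateClock_eq, earlyClock_eq, hf, hfr, max_eq_right (by linarith), min_eq_left (by linarith)]
  push_cast
  constructor <;> ring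

/-- A clock on `[0, n]` rescaled to the unit interval. -/
noncomputable def scaledClock (F : ℝ → ℝ) (n : ℕ) (s : I) : I :=
  projIcc 0 1 zero_le_one (F (n * s) / n)

section scaledClock

variable {F : ℝ → ℝ} {n : ℕ}

theorem continuous_scaledClock (hF : Continuous F) : Continuous (scaledClock F n) :=
  continuous_projIcc.comp (by fun_prop)

theorem monotone_scaledClock (hF : Monotone F) : Monotone (scaledClock F n) := by
  intro s t hst
  have : (s : ℝ) ≤ t := hst
  refine monotone_projIcc _ ?_
  gcongr
  apply hF
  gcongr

/-- The clock fixes `0` and `n`, so it maps `[0, n]` to itself and the projection in `scaledClock`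
does nothing. -/
theorem mul_coe_scaledClock (hn : 1 ≤ n) (hF : Monotone F) (hk : ∀ k : ℕ, F k = k) (s : I) :
    n * (scaledClock F n s : ℝ) = F (n * s) := by
  have hn0 : (0 : ℝ) < n := by exact_mod_cast hn
  have h0 : 0 ≤ F (n * s) := by
    rw [← Nat.cast_zero, ← hk 0]
    exact hF (by have := s.2.1; push_cast; positivity)
  have h1 : F (n * s) ≤ n := by
    conv_rhs => rw [← hk n]
    exact hF (mul_le_of_le_one_right hn0.le s.2.2)
  rw [scaledClock, projIcc_of_mem zero_le_one ⟨by positivity, div_le_one_of_le₀ h1 hn0.le⟩]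
  exact mul_div_cancel₀ _ hn0.ne'

theorem surjective_scaledClock (hn : 1 ≤ n) (hF : Monotone F) (hFc : Continuous F)
    (hk : ∀ k : ℕ, F k = k) : Function.Surjective (scaledClock F n) := by
  have hn0 : (0 : ℝ) < n := by exact_mod_cast hn
  intro t
  refine mem_range_of_exists_le_of_exists_ge (continuous_scaledClock hFc) ⟨0, ?_⟩ ⟨1, ?_⟩
  · have h := mul_coe_scaledClock hn hF hk 0
    have h0 := hk 0
    rw [Nat.cast_zero] at h0
    rw [Icc.coe_zero, mul_zero, h0] at h
    rw [← Subtype.coe_le_coe, (mul_eq_zero_iff_left hn0.ne').1 h]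
    exact t.2.1
  · have h := mul_coe_scaledClock hn hF hk 1
    rw [Icc.coe_one, mul_one, hk, mul_eq_left₀ hn0.ne'] at h
    rw [← Subtype.coe_le_coe, h]
    exact t.2.2

end scaledClock

theorem exists_nat_cell {n : ℕ} (hn : 1 ≤ n) (s : I) :
    ∃ k < n, (k : ℝ) ≤ n * s ∧ (n : ℝ) * s ≤ k + 1 := by
  have hn0 : (0 : ℝ) < n := by exact_mod_cast hn
  rcases (unitInterval.nonneg' : 0 ≤ s).eq_or_lt with rfl | hs
  · exact ⟨0, hn, by simp, by simp⟩
  · obtain ⟨k, hk, h1, h2⟩ := exists_grid_cell hn hs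
    exact ⟨k, hk, ((div_lt_iff₀' hn0).1 h1).le, (le_div_iff₀' hn0).1 h2⟩

/-! ### Representations of continuous paths and of step functions -/

namespace SkorokhodSpace

variable {d : ℕ} {x : SkorokhodSpace d}

theorem leftLimit_eq_of_continuous (hx : Continuous x) (t : I) : x.leftLimit t = x t := by
  rcases (unitInterval.nonneg' : 0 ≤ t).eq_or_lt with rfl | ht
  · exact x.leftLimit_zero
  · exact x.leftLimit_eq_of_eqOn ht hx.continuousAt fun _ _ _ => rfl

theorem isParamRep_of_continuous (hx : Continuous x) {r : I → I} (hc : Continuous r)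
    (hm : Monotone r) (hs : Function.Surjective r) : x.IsParamRep (fun s => x (r s)) r where
  cont_u := hx.comp hc
  cont_r := hc
  range_eq := by
    ext ⟨z, t⟩
    simp only [completeGraph, mem_ofPred_eq, leftLimit_eq_of_continuous hx, segment_same,
      mem_singleton_iff, mem_range, Prod.mk.injEq]
    constructor
    · rintro ⟨s, rfl, rfl⟩; rfl
    · rintro rfl
      obtain ⟨s, rfl⟩ := hs t
      exact ⟨s, rfl, rfl⟩
  mono s t hst := by
    rcases (hm hst).lt_or_eq with h | h
    · exact Or.inl h
    · exact Or.inr ⟨h, by dsimp only; rw [h]⟩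

end SkorokhodSpace

namespace IsSkorokhodEmbedding

open AffineMap

variable {d n : ℕ} {y : ℕ → Rd d} {x : SkorokhodSpace d}

theorem leftLimit_of_M1 (h : IsSkorokhodEmbedding .M1 n y x) {k : ℕ} (hk : k < n) {t : I}
    (ht : (k : ℝ) < n * t) (ht' : (n : ℝ) * t ≤ k + 1) :
    x.leftLimit t = lineMap (y k) (y (k + 1)) (n * t - k : ℝ) := by
  have hn0 : (0 : ℝ) < n := by exact_mod_cast (Nat.zero_le k).trans_lt hk
  obtain ⟨a, ha⟩ := exists_coe_eq_div hk.le
  refine x.leftLimit_eq_of_eqOn (a := a)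
    (g := fun t : I => lineMap (y k) (y (k + 1)) (n * t - k : ℝ)) ?_ ?_ fun s h2 h3 => ?_
  · rw [← Subtype.coe_lt_coe, ha]
    exact (div_lt_iff₀' hn0).2 ht
  · exact (lineMap_continuous.comp (by fun_prop)).continuousAt
  · have h3 : (s : ℝ) < t := h3
    have := h.between k hk s (by rw [← ha]; exact h2) (by rw [lt_div_iff₀' hn0]; nlinarith)
    rw [show x s = _ from this, lineMap_apply_module', add_comm]
    congr 2
    field_simp

theorem apply_of_M1 (h : IsSkorokhodEmbedding .M1 n y x) {k : ℕ} (hk : k < n) {t : I}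
    (ht : (k : ℝ) ≤ n * t) (ht' : (n : ℝ) * t ≤ k + 1) :
    x t = lineMap (y k) (y (k + 1)) (n * t - k : ℝ) := by
  have hn0 : (0 : ℝ) < n := by exact_mod_cast (Nat.zero_le k).trans_lt hk
  rcases ht.eq_or_lt with h1 | h1
  · rw [h.at_grid k hk t (by rw [h1]; field_simp), ← h1]; simp
  rcases ht'.eq_or_lt with h2 | h2
  · rcases Nat.lt_or_ge (k + 1) n with h3 | h3
    · rw [h.at_grid (k + 1) h3 t (by push_cast; rw [← h2]; field_simp), h2]; simp
    · have : t = 1 := by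
        have h4 : (k : ℝ) + 1 = n := by exact_mod_cast (show k + 1 = n by omega)
        rw [h4, mul_eq_left₀ hn0.ne'] at h2
        exact Subtype.ext h2
      rw [← h.leftLimit_of_M1 hk h1 ht', this, x.leftLimit_one]
  · have := h.between k hk t ((div_lt_iff₀' hn0).2 h1) ((lt_div_iff₀' hn0).2 h2)
    rw [show x t = _ from this, lineMap_apply_module', add_comm]
    congr 2
    field_simp

theorem continuous_of_M1 (h : IsSkorokhodEmbedding .M1 n y x) (hn : 1 ≤ n) : Continuous x := by
  have hn0 : (0 : ℝ) < n := by exact_mod_cast hn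
  rw [continuous_iff_continuousAt]
  intro t
  rw [continuousAt_iff_continuous_left'_right']
  refine ⟨?_, x.right_cont t⟩
  rcases (unitInterval.nonneg' : 0 ≤ t).eq_or_lt with rfl | ht
  · simp [ContinuousWithinAt]
  · obtain ⟨k, hk, h1, h2⟩ := exists_grid_cell hn ht
    rw [div_lt_iff₀' hn0] at h1
    rw [le_div_iff₀' hn0] at h2
    have := x.tendsto_leftLimit ht
    rwa [h.leftLimit_of_M1 hk h1 h2, ← h.apply_of_M1 hk h1.le h2] at this

/-- The parametric representation of a step function that traverses the polygon `P` through its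
values during the jumps. -/
theorem isParamRep_of_J1 (h : IsSkorokhodEmbedding .J1 n y x) (hn : 1 ≤ n) {P : I → Rd d}
    (hPc : Continuous P) (hP : ∀ k < n, ∀ t : I, (k : ℝ) ≤ n * t → (n : ℝ) * t ≤ k + 1 →
      P t = lineMap (y (min k (n - 1))) (y (min (k + 1) (n - 1))) (n * t - k : ℝ)) :
    x.IsParamRep (fun s => P (scaledClock lateClock n s)) (scaledClock earlyClock n) := by
  have hn0 : (0 : ℝ) < n := by exact_mod_cast hn
  have hA := mul_coe_scaledClock hn monotone_lateClock lateClock_natCast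
  have hB := mul_coe_scaledClock hn monotone_earlyClock earlyClock_natCast
  have hext {s t : I} (hst : (n : ℝ) * s = n * t) : s = t :=
    Subtype.ext (mul_left_cancel₀ hn0.ne' hst)
  have hmin {k : ℕ} (hk : k < n) : min k (n - 1) = k := by omega
  -- In the first half of a cell space rests at `y k` while time crosses the cell; in the second
  -- half time rests at `(k+1)/n` while space traverses the jump. Indices are capped at `n - 1`
  -- because the step function has no jump at time `1`.
  have hrest {k : ℕ} (hk : k < n) {s : I} (h1 : (k : ℝ) ≤ n * s) (h2 : (n : ℝ) * s ≤ k + 1 / 2) :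
      P (scaledClock lateClock n s) = y k := by
    have h3 := hA s
    rw [(clock_of_le_half h1 h2).1] at h3
    rw [hP k hk _ h3.ge (by linarith), h3, hmin hk]
    simp
  have hmove {k : ℕ} (hk : k < n) {s : I} (h1 : (k : ℝ) + 1 / 2 ≤ n * s)
      (h2 : (n : ℝ) * s ≤ k + 1) : P (scaledClock lateClock n s) =
        lineMap (y k) (y (min (k + 1) (n - 1))) (2 * (n * s) - 2 * k - 1 : ℝ) := by
    have h3 := hA s
    rw [(clock_of_half_le h1 h2).1] at h3
    rw [hP k hk _ (by linarith) (by linarith), h3, hmin hk]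
    congr 1
    ring
  have hleft {k : ℕ} (hk : k < n) {t : I} (ht : (k : ℝ) < n * t) (ht' : (n : ℝ) * t ≤ k + 1) :
      x.leftLimit t = y k :=
    h.leftLimit_of_J1 hk ((div_lt_iff₀' hn0).2 ht) ((le_div_iff₀' hn0).2 ht')
  have hstep {k : ℕ} (hk : k < n) {t : I} (ht : (k : ℝ) ≤ n * t) (ht' : (n : ℝ) * t < k + 1) :
      x t = y k :=
    h.apply_of_J1 hk ((div_le_iff₀' hn0).2 ht) ((lt_div_iff₀' hn0).2 ht')
  have hjump {k : ℕ} (hk : k < n) {t : I} (ht : (n : ℝ) * t = k + 1) :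
      x t = y (min (k + 1) (n - 1)) := by
    rcases Nat.lt_or_ge (k + 1) n with h3 | h3
    · rw [hmin h3]
      exact h.at_grid _ h3 t (by push_cast; rw [← ht]; field_simp)
    · have h4 : (k : ℝ) + 1 = n := by exact_mod_cast (show k + 1 = n by omega)
      have h5 : t = 1 := hext (by rw [ht, h4]; simp)
      rw [h5, h.apply_one_of_J1 hn, min_eq_right (by omega)]
  refine ⟨hPc.comp (continuous_scaledClock continuous_lateClock),
    continuous_scaledClock continuous_earlyClock, ?_, fun s s' hs => ?_⟩
  · ext ⟨z, t⟩
    simp only [mem_range, Prod.mk.injEq]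
    constructor
    · rintro ⟨s, rfl, rfl⟩
      change _ ∈ segment ℝ _ _
      dsimp only
      obtain ⟨k, hk, h1, h2⟩ := exists_nat_cell hn s
      have h4 := hB s
      rcases le_total ((n : ℝ) * s) (k + 1 / 2) with h3 | h3
      · rw [(clock_of_le_half h1 h3).2] at h4
        rw [hrest hk h1 h3]
        rcases lt_or_ge ((n : ℝ) * s) (k + 1 / 2) with h5 | h5
        · rw [hstep hk (by linarith) (by linarith)]
          exact right_mem_segment _ _ _
        · rw [hleft hk (by linarith) (by linarith)]
          exact left_mem_segment _ _ _
      · rw [(clock_of_half_le h3 h2).2] at h4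
        rw [hmove hk h3 h2, hleft hk (by linarith) h4.le, hjump hk h4, segment_eq_image_lineMap]
        exact mem_image_of_mem _ ⟨by linarith, by linarith⟩
    · intro hz
      have hz : z ∈ segment ℝ (x.leftLimit t) (x t) := hz
      have ht1 : (n : ℝ) * t ≤ n := mul_le_of_le_one_right hn0.le t.2.2
      rcases (unitInterval.nonneg' : 0 ≤ t).eq_or_lt with rfl | ht
      · rw [x.leftLimit_zero, segment_same, mem_singleton_iff, h.eq_zero hn] at hz
        refine ⟨0, ?_, hext ?_⟩
        · rw [hz]; exact hrest (k := 0) hn (by simp) (by simp)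
        · rw [hB, (clock_of_le_half (k := 0) (by simp) (by simp)).2]; simp
      obtain ⟨k, hk, h1, h2⟩ := exists_grid_cell hn ht
      rw [div_lt_iff₀' hn0] at h1
      rw [le_div_iff₀' hn0] at h2
      have hk1 : (k : ℝ) + 1 ≤ n := by exact_mod_cast hk
      have hsol {v : ℝ} (hv0 : (k : ℝ) ≤ v) (hv1 : v ≤ k + 1) : ∃ s : I, (n : ℝ) * s = v :=
        ⟨⟨v / n, div_nonneg ((Nat.cast_nonneg k).trans hv0) hn0.le,
          div_le_one_of_le₀ (hv1.trans hk1) hn0.le⟩, mul_div_cancel₀ _ hn0.ne'⟩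
      rcases h2.lt_or_eq with h3 | h3
      · rw [hleft hk h1 h2, hstep hk h1.le h3, segment_same, mem_singleton_iff] at hz
        -- Solution of `2 * v - k = n * t`, the early clock on a first half.
        obtain ⟨s, hs⟩ := hsol (v := (n * t + k) / 2) (by linarith) (by linarith)
        have hs1 : (k : ℝ) ≤ n * s := by linarith
        have hs2 : (n : ℝ) * s ≤ k + 1 / 2 := by linarith
        refine ⟨s, ?_, hext ?_⟩
        · rw [hz, hrest hk hs1 hs2]
        · rw [hB, (clock_of_le_half hs1 hs2).2]; linarith
      · rw [hleft hk h1 h2, hjump hk h3, segment_eq_image_lineMap] at hz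
        obtain ⟨c, hc, rfl⟩ := hz
        have := hc.1
        have := hc.2
        -- Solution of `2 * v - 2 * k - 1 = c`, the position along the jump on a second half.
        obtain ⟨s, hs⟩ := hsol (v := k + 1 / 2 + c / 2) (by linarith) (by linarith)
        have hs1 : (k : ℝ) + 1 / 2 ≤ n * s := by linarith
        have hs2 : (n : ℝ) * s ≤ k + 1 := by linarith
        refine ⟨s, ?_, hext ?_⟩
        · rw [hmove hk hs1 hs2]
          congr 1
          linarith
        · rw [hB, (clock_of_half_le hs1 hs2).2, h3]
  · rcases (monotone_scaledClock (n := n) monotone_earlyClock hs).lt_or_eq with h1 | h1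
    · exact Or.inl h1
    refine Or.inr ⟨h1, ?_⟩
    rcases hs.eq_or_lt with rfl | hs
    · rfl
    dsimp only
    -- The early clock is constant only on second halves of cells, so `s` and `s'` both lie in one
    -- such half, where the distance to `y k` grows linearly.
    obtain ⟨k, hk, h2, h3⟩ := exists_grid_cell hn (unitInterval.nonneg'.trans_lt hs)
    rw [div_lt_iff₀' hn0] at h2
    rw [le_div_iff₀' hn0] at h3
    have hss : (n : ℝ) * s < n * s' := mul_lt_mul_of_pos_left hs hn0
    have hb : earlyClock (n * s) = earlyClock (n * s') := by rw [← hB, ← hB, h1]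
    have hks : (k : ℝ) ≤ n * s := by
      by_contra! hlt
      have h4 := monotone_earlyClock hlt.le
      rw [earlyClock_natCast, hb] at h4
      rcases le_total ((n : ℝ) * s') (k + 1 / 2) with h5 | h5
      · rw [(clock_of_le_half h2.le h5).2] at h4; linarith
      · rw [(clock_of_half_le h5 h3).2] at h4; linarith
    have hks2 : (k : ℝ) + 1 / 2 ≤ n * s := by
      by_contra! hlt
      rw [(clock_of_le_half hks hlt.le).2] at hb
      rcases le_total ((n : ℝ) * s') (k + 1 / 2) with h5 | h5
      · rw [(clock_of_le_half h2.le h5).2] at hb; linarith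
      · rw [(clock_of_half_le h5 h3).2] at hb; linarith
    have hB' := hB s'
    rw [(clock_of_half_le (hks2.trans hss.le) h3).2] at hB'
    rw [h1, hleft hk (by linarith) hB'.le, hmove hk hks2 (hss.le.trans h3),
      hmove hk (hks2.trans hss.le) h3, dist_left_lineMap, dist_left_lineMap,
      Real.norm_of_nonneg (by linarith), Real.norm_of_nonneg (by linarith)]
    gcongr

end IsSkorokhodEmbedding

/-! ### The estimate for M1 and the common bound -/

namespace IsSkorokhodEmbedding

open AffineMap

variable {d n : ℕ} {y : ℕ → Rd d} {x x' : SkorokhodSpace d}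

theorem dist_scaledClock_le (hn : 1 ≤ n) (s : I) :
    dist (scaledClock lateClock n s) (scaledClock earlyClock n s) ≤ 1 / n := by
  have hn0 : (0 : ℝ) < n := by exact_mod_cast hn
  have hA := mul_coe_scaledClock hn monotone_lateClock lateClock_natCast s
  have hB := mul_coe_scaledClock hn monotone_earlyClock earlyClock_natCast s
  obtain ⟨k, hk, h1, h2⟩ := exists_nat_cell hn s
  refine dist_le_one_div_of_cell (k := k) ((div_le_iff₀' hn0).2 ?_) ((le_div_iff₀' hn0).2 ?_)
    ((div_le_iff₀' hn0).2 ?_) ((le_div_iff₀' hn0).2 ?_) <;>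
  rcases le_total ((n : ℝ) * s) (k + 1 / 2) with h3 | h3
  · rw [hA, (clock_of_le_half h1 h3).1]
  · rw [hA, (clock_of_half_le h3 h2).1]; linarith
  · rw [hA, (clock_of_le_half h1 h3).1]; linarith
  · rw [hA, (clock_of_half_le h3 h2).1]; linarith
  · rw [hB, (clock_of_le_half h1 h3).2]; linarith
  · rw [hB, (clock_of_half_le h3 h2).2]; linarith
  · rw [hB, (clock_of_le_half h1 h3).2]; linarith
  · rw [hB, (clock_of_half_le h3 h2).2]

theorem exists_isParamRep_of_M1_of_J1 (h : IsSkorokhodEmbedding .M1 n y x)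
    (h' : IsSkorokhodEmbedding .J1 n y x') (hn : 1 ≤ n) :
    ∃ u r u' r', x.IsParamRep u r ∧ x'.IsParamRep u' r' ∧
      (∀ s, dist (u s) (u' s) ≤ embeddingError n y) ∧
      ∀ s, dist (r s) (r' s) ≤ embeddingError n y := by
  have hn0 : (0 : ℝ) < n := by exact_mod_cast hn
  have hx := h.continuous_of_M1 hn
  have hlast : n - 1 < n := Nat.sub_lt hn one_pos
  have hcast : ((n - 1 : ℕ) : ℝ) + 1 = n := by exact_mod_cast Nat.sub_add_cancel hn
  obtain ⟨e, he⟩ := exists_coe_eq_div hlast.le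
  have hne : (n : ℝ) * e = (n - 1 : ℕ) := by rw [he]; field_simp
  have hxe : x e = y (n - 1) := h.at_grid _ hlast e he
  -- The polygon is frozen from time `e = (n-1)/n` on, since the step function never moves towards
  -- `y n`; this is the only spatial discrepancy, and it stays within `|y n - y (n - 1)|`.
  have hPc : Continuous fun t => x (min t e) := hx.comp (continuous_id.min continuous_const)
  refine ⟨_, _, _, _, x.isParamRep_of_continuous hx
    (continuous_scaledClock (n := n) continuous_lateClock)
    (monotone_scaledClock monotone_lateClock)
    (surjective_scaledClock hn monotone_lateClock continuous_lateClock lateClock_natCast),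
    h'.isParamRep_of_J1 hn hPc fun k hk t h1 h2 => ?_, fun s => ?_,
    fun s => (dist_scaledClock_le hn s).trans (le_max_left _ _)⟩
  · rcases Nat.lt_or_ge (k + 1) n with h3 | h3
    · have hte : t ≤ e := by
        have h4 : (k : ℝ) + 1 ≤ (n - 1 : ℕ) := by exact_mod_cast (show k + 1 ≤ n - 1 by omega)
        exact Subtype.coe_le_coe.1
          (le_of_mul_le_mul_left (by linarith : (n : ℝ) * t ≤ n * e) hn0)
      rw [min_eq_left hte, min_eq_left (by omega), min_eq_left (by omega)]
      exact h.apply_of_M1 hk h1 h2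
    · have hk' : k = n - 1 := by omega
      have het : e ≤ t :=
        Subtype.coe_le_coe.1
          (le_of_mul_le_mul_left (by rw [hne, ← hk']; exact h1 : (n : ℝ) * e ≤ n * t) hn0)
      rw [min_eq_right het, hxe, min_eq_right (by omega), min_eq_right (by omega)]
      simp
  · set t := scaledClock lateClock n s
    rcases le_total t e with hte | het
    · rw [min_eq_left hte, dist_self]
      exact dist_nonneg.trans (le_max_right _ _)
    · have h1 : ((n - 1 : ℕ) : ℝ) ≤ n * t := by
        rw [← hne]
        exact mul_le_mul_of_nonneg_left het hn0.le
      have h2 : (n : ℝ) * t ≤ (n - 1 : ℕ) + 1 := by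
        rw [hcast]
        exact mul_le_of_le_one_right hn0.le t.2.2
      rw [min_eq_right het, hxe, h.apply_of_M1 hlast h1 h2, dist_lineMap_left,
        Real.norm_of_nonneg (by linarith), Nat.sub_add_cancel hn, dist_comm]
      exact (mul_le_of_le_one_left dist_nonneg (by linarith)).trans (le_max_right _ _)

theorem distM1_le_of_J1 (h : IsSkorokhodEmbedding .M1 n y x)
    (h' : IsSkorokhodEmbedding .J1 n y x') (hn : 1 ≤ n) :
    x.distM1 x' ≤ ENNReal.ofReal (embeddingError n y) ∧
      x'.distM1 x ≤ ENNReal.ofReal (embeddingError n y) := by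
  obtain ⟨u, r, u', r', h1, h2, hu, hr⟩ := h.exists_isParamRep_of_M1_of_J1 h' hn
  refine ⟨SkorokhodSpace.distM1_le h1 h2 (fun t => ?_) fun t => ?_,
    SkorokhodSpace.distM1_le h2 h1 (fun t => ?_) fun t => ?_⟩
  · rw [edist_dist]; exact ENNReal.ofReal_le_ofReal (hu t)
  · rw [edist_dist]; exact ENNReal.ofReal_le_ofReal (hr t)
  · rw [edist_comm, edist_dist]; exact ENNReal.ofReal_le_ofReal (hu t)
  · rw [edist_comm, edist_dist]; exact ENNReal.ofReal_le_ofReal (hr t)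

theorem skorokhodDist_le {T : SkorokhodTopology} (hT : T ≠ .J1)
    (h : IsSkorokhodEmbedding T n y x) (h' : IsSkorokhodEmbedding .J1 n y x') (hn : 1 ≤ n) :
    skorokhodDist T x x' ≤ ENNReal.ofReal (embeddingError n y) ∧
      skorokhodDist T x' x ≤ ENNReal.ofReal (embeddingError n y) := by
  cases T with
  | J1 => exact absurd rfl hT
  | J2 => exact ⟨h.distJ2_le h'.toJ2 hn, h'.toJ2.distJ2_le h hn⟩
  | M1 => exact h.distM1_le_of_J1 h' hn
  | M2 => exact ⟨h.distM2_le h'.toM2 hn, h'.toM2.distM2_le h hn⟩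

end IsSkorokhodEmbedding

/-! ### Transfer of convergence -/

theorem skorokhodDist_triangle {d : ℕ} {T : SkorokhodTopology} (hT : T ≠ .J1)
    (f g h : SkorokhodSpace d) :
    skorokhodDist T f h ≤ skorokhodDist T f g + skorokhodDist T g h := by
  cases T with
  | J1 => exact absurd rfl hT
  | J2 => exact Metric.hausdorffEDist_triangle
  | M1 => exact SkorokhodSpace.distM1_triangle f g h
  | M2 => exact Metric.hausdorffEDist_triangle

theorem SkorokhodConverges.of_dist_le {d : ℕ} {T : SkorokhodTopology} (hT : T ≠ .J1)
    {x x' : ℕ → SkorokhodSpace d} {f : SkorokhodSpace d} {e : ℕ → ℝ≥0∞}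
    (he : Tendsto e atTop (𝓝 0)) (hd : ∀ᶠ n in atTop, skorokhodDist T (x' n) (x n) ≤ e n)
    (h : SkorokhodConverges T x f) : SkorokhodConverges T x' f := by
  have h0 : Tendsto (fun n => e n + skorokhodDist T (x n) f) atTop (𝓝 0) := by
    simpa using he.add h
  refine tendsto_of_tendsto_of_tendsto_of_le_of_le' tendsto_const_nhds h0
    (Eventually.of_forall fun _ => zero_le) ?_
  filter_upwards [hd] with n hn
  exact (skorokhodDist_triangle hT _ (x n) _).trans (add_le_add hn le_rfl)

theorem tendsto_embeddingError {d : ℕ} {y : ℕ → ℕ → Rd d}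
    (hy : Tendsto (fun n : ℕ => dist (y n n) (y n (n - 1))) atTop (𝓝 0)) :
    Tendsto (fun n => ENNReal.ofReal (embeddingError n (y n))) atTop (𝓝 0) := by
  rw [← ENNReal.ofReal_zero]
  refine ENNReal.tendsto_ofReal ?_
  simpa [embeddingError] using (tendsto_one_div_atTop_nhds_zero_nat (𝕜 := ℝ)).max hy

theorem mainTheorem3 (d : ℕ) (T : SkorokhodTopology) (y : ℕ → ℕ → Rd d)
    (xT xJ : ℕ → SkorokhodSpace d)
    (hT : ∀ n : ℕ, 1 ≤ n → IsSkorokhodEmbedding T n (y n) (xT n))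
    (hJ : ∀ n : ℕ, 1 ≤ n → IsSkorokhodEmbedding SkorokhodTopology.J1 n (y n) (xJ n))
    (hy : T ≠ SkorokhodTopology.J1 →
      Tendsto (fun n : ℕ => dist (y n n) (y n (n - 1))) atTop (𝓝 0)) :
    ((∃ f : SkorokhodSpace d, SkorokhodConverges T xT f) ↔
        ∃ f : SkorokhodSpace d, SkorokhodConverges T xJ f) ∧
      ∀ f : SkorokhodSpace d, SkorokhodConverges T xT f ↔ SkorokhodConverges T xJ f := by
  suffices key : ∀ f : SkorokhodSpace d, SkorokhodConverges T xT f ↔ SkorokhodConverges T xJ f from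
    ⟨exists_congr key, key⟩
  intro f
  rcases eq_or_ne T .J1 with rfl | hT1
  · refine tendsto_congr' ?_
    filter_upwards [eventually_ge_atTop 1] with n hn
    rw [(hT n hn).eq_of_J1 (hJ n hn) hn]
  · have he := tendsto_embeddingError (hy hT1)
    have hd : ∀ᶠ n in atTop, _ := (eventually_ge_atTop 1).mono fun n hn =>
      (hT n hn).skorokhodDist_le hT1 (hJ n hn) hn
    exact ⟨.of_dist_le hT1 he (hd.mono fun _ h => h.2),
      .of_dist_le hT1 he (hd.mono fun _ h => h.1)⟩
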